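/- Let $p$ be a prime. A system $\Psi=(\psi_1,\dots,\psi_t)$ consists of linear forms $\psi_i:\mathbb F_p^D\to\mathbb F_p$ such that $\psi_1(x)=\dots=\psi_t(x)=0$ only for $x=0$. Applying each $\psi_i$ coordinatewise to $(\mathbb F_p^n)^D$, set, for $f:\mathbb F_p^n\to\mathbb R$, $$T_\Psi(f)=\mathbb E_{x_1,\dots,x_D\in\mathbb F_p^n}\ \prod_{i=1}^t f(\psi_i(x_1,\dots,x_D)),$$ where $\mathbb E$ denotes the average. * $\Psi$ has complexity $s$ if $s$ is the smallest positive integer for which the functions $\psi_1^{s+1},\dots,\psi_t^{s+1}$ on $\mathbb F_p^D$ are linearly independent over $\mathbb F_p$. * $\Psi$ is locally Sidorenko if for every $\alpha\in[0,1]$ there is $\varepsilon>0$ such that for all $n\ge 1$ and all $f:\mathbb F_p^n\to[-\alpha,1-\alpha]$ with $\mathbb E f=0$ we have $T_\Psi(\alpha+\varepsilon f)\ge\alpha^t$. * $\Psi$ is weakly locally Sidorenko if for all $n\ge1$, all $\alpha\in[0,1]$ and all $f:\mathbb F_p^n\to[-\alpha,1-\alpha]$ with $\mathbb E f=0$ there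 is $\varepsilon_f>0$ such that $T_\Psi(\alpha+\varepsilon f)\ge\alpha^t$ for all $0<\varepsilon<\varepsilon_f$. **Corollary.** Let $p\notin\{2,3\}$ be a prime. Among complexity one systems over $\mathbb F_p$, being weakly locally Sidorenko is not equivalent to being locally Sidorenko. Explicitly, there are systems of five linear forms whose image is the solution set in $\mathbb F_p^5$ of $$x_1-x_2+x_3-x_4=0,\qquad x_1+2x_2-x_3-2x_5=0,$$ and every such system has complexity one, is weakly locally Sidorenko, and is not locally Sidorenko. -/

import Mathlib

open scoped BigOperators

/-- A system `(ψ₁, …, ψ_t)` of `t` linear forms, each mapping `𝔽_p^D` to `𝔽_p`. -/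
abbrev FormSystem (p D t : ℕ) : Type :=
  Fin t → ((Fin D → ZMod p) →ₗ[ZMod p] ZMod p)

namespace FormSystem

/-- The map `𝔽_p^D → 𝔽_p^t`, `x ↦ (ψ₁ x, …, ψ_t x)`. -/
def toMap {p D t : ℕ} (Ψ : FormSystem p D t) :
    (Fin D → ZMod p) →ₗ[ZMod p] (Fin t → ZMod p) :=
  LinearMap.pi Ψ

/-- The standing convention `Ψ⁻¹(0) = 0` (which forces `D ≤ t`). -/
def Nondegenerate {p D t : ℕ} (Ψ : FormSystem p D t) : Prop :=
  LinearMap.ker Ψ.toMap = ⊥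

/-- The image of `Ψ` is the solution set of the homogeneous linear equations whose coefficients
are the rows of `M`. -/
def IsDefinedBy {p D t m : ℕ} (Ψ : FormSystem p D t) (M : Matrix (Fin m) (Fin t) (ZMod p)) :
    Prop :=
  LinearMap.range Ψ.toMap = LinearMap.ker M.mulVecLin

/-- The map `(𝔽_p^n)^D → 𝔽_p^n` induced by the form `ψ_i`: it applies `ψ_i` in each of the
`n` coordinates. -/
def induced {p D t : ℕ} (Ψ : FormSystem p D t) (i : Fin t) {n : ℕ}
    (x : Fin D → Fin n → ZMod p) : Fin n → ZMod p :=
  fun k => Ψ i (fun d => x d k)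

/-- `T_Ψ(f) = 𝔼_{x₁, …, x_D ∈ 𝔽_p^n} f(ψ₁(x₁, …, x_D)) ⋯ f(ψ_t(x₁, …, x_D))`,
where `𝔼` is the average. -/
noncomputable def T {p D t : ℕ} [Fact p.Prime] (Ψ : FormSystem p D t) {n : ℕ}
    (f : (Fin n → ZMod p) → ℝ) : ℝ :=
  𝔼 x : Fin D → Fin n → ZMod p, ∏ i : Fin t, f (Ψ.induced i x)

/-- `s` is the complexity of `Ψ`: the smallest positive integer such that the functions
`ψ₁^(s+1), …, ψ_t^(s+1)` on `𝔽_p^D` are linearly independent over `𝔽_p`. -/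
def HasComplexity {p D t : ℕ} (Ψ : FormSystem p D t) (s : ℕ) : Prop :=
  IsLeast {s : ℕ | 0 < s ∧ LinearIndependent (ZMod p)
    (fun (i : Fin t) (x : Fin D → ZMod p) => (Ψ i x) ^ (s + 1))} s

/-- `f : 𝔽_p^n → [-α, 1-α]` and `𝔼 f = 0`. -/
def IsPerturbation {p n : ℕ} [Fact p.Prime] (α : ℝ) (f : (Fin n → ZMod p) → ℝ) : Prop :=
  (∀ x, f x ∈ Set.Icc (-α) (1 - α)) ∧ 𝔼 x : Fin n → ZMod p, f x = 0

/-- Locally Sidorenko: the radius `ε` depends on `α` only. -/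
def IsLocallySidorenko {p D t : ℕ} [Fact p.Prime] (Ψ : FormSystem p D t) : Prop :=
  ∀ α ∈ Set.Icc (0 : ℝ) 1, ∃ ε : ℝ, 0 < ε ∧
    ∀ n : ℕ, 1 ≤ n → ∀ f : (Fin n → ZMod p) → ℝ, IsPerturbation α f →
      α ^ t ≤ Ψ.T (fun x => α + ε * f x)

/-- Weakly locally Sidorenko: the radius may depend on `n`, `α` and `f`. -/
def IsWeaklyLocallySidorenko {p D t : ℕ} [Fact p.Prime] (Ψ : FormSystem p D t) : Prop :=
  ∀ n : ℕ, 1 ≤ n → ∀ α ∈ Set.Icc (0 : ℝ) 1,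
    ∀ f : (Fin n → ZMod p) → ℝ, IsPerturbation α f →
      ∃ εf : ℝ, 0 < εf ∧ ∀ ε : ℝ, 0 < ε → ε < εf →
        α ^ t ≤ Ψ.T (fun x => α + ε * f x)

/-- The equations `x₁ - x₂ + x₃ - x₄ = 0` and `x₁ + 2x₂ - x₃ - 2x₅ = 0`. -/
def exampleMatrix (p : ℕ) : Matrix (Fin 2) (Fin 5) (ZMod p) :=
  !![1, -1, 1, -1, 0;
     1, 2, -1, 0, -2]

end FormSystem

/-! On the Fourier side the average is a sum over frequencies (a, b), with one factor for each of a
+ b, 2b - a, a - b, -a, -2b: the coordinates of a times the first equation plus b times the second.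
As 2 and 3 are invertible, any two of these frequencies vanish together only at a = b = 0. For f of
mean zero, the expansion of T(α + εf) therefore has no terms of order 1, 2, 3 in ε and equals α^5 +
α ε^4 Q(f) + ε^5 T(f), where Q(f) is `quarticPart` (`exampleAvg_const_add`).

Weak property: Q(f) is at least half the sum of the |f̂(ξ)|^4 (`re_quarticPart_ge`), so it is
positive for f ≠ 0 and dominates once ε is small in terms of f.

Failure of uniformity: Q(f) can be far smaller than |T(f)|. Let q be the normalized indicator of a
split quadric in dimension 2m, minus one, and M = p^m. Its Fourier coefficients are at most p/M and
there are M^2 frequencies, so the quartic term is O(M^(-2)). Yet some combination of the squares of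
the five forms, with all coefficients nonzero, has rank one, and this forces T(q) ≥ 1/M
(`re_exampleAvg_quadricFun_ge`). Recentring q, negating it and letting m grow defeats every fixed ε
at α = 1/2 (`exists_counterexample`). -/

/-! ### Fourier analysis on 𝔽_p^ι and the average over the example variety. -/

section Fourier

variable {p : ℕ} [Fact p.Prime] {ι : Type*} [Fintype ι] [DecidableEq ι]

/-- The standard additive character of `𝔽_p`. -/
noncomputable def stdChar (p : ℕ) [Fact p.Prime] : AddChar (ZMod p) ℂ := ZMod.stdAddChar

lemma stdChar_norm (a : ZMod p) : ‖stdChar p a‖ = 1 := by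
  simp [stdChar, ZMod.stdAddChar_apply, Circle.norm_coe]

lemma star_stdChar (a : ZMod p) : (starRingEnd ℂ) (stdChar p a) = stdChar p (-a) := by
  rw [AddChar.map_neg_eq_conj]

lemma stdChar_isPrimitive : (stdChar p).IsPrimitive := ZMod.isPrimitive_stdAddChar p

lemma sum_stdChar_dot (x : ι → ZMod p) :
    ∑ ξ : ι → ZMod p, stdChar p (ξ ⬝ᵥ x) =
      if x = 0 then (Fintype.card (ι → ZMod p) : ℂ) else 0 := by
  split_ifs with hx
  · simp [hx]
  · obtain ⟨i, hi⟩ := Function.ne_iff.mp hx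
    let φ : AddChar (ι → ZMod p) ℂ :=
      { toFun := fun ξ => stdChar p (ξ ⬝ᵥ x)
        map_zero_eq_one' := by simp
        map_add_eq_mul' := fun a b => by rw [add_dotProduct, AddChar.map_add_eq_mul] }
    have hφ : φ ≠ 1 := by
      intro h
      have h1 : stdChar p = 1 := by
        ext a
        have := DFunLike.congr_fun h (Pi.single i (a / x i))
        have h2 : φ (Pi.single i (a / x i)) = stdChar p a := by
          change stdChar p ((Pi.single i (a / x i)) ⬝ᵥ x) = _
          rw [single_dotProduct, div_mul_cancel₀ _ hi]
        rw [← h2, this]; simp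
      have := (stdChar_isPrimitive (p := p)).zmod_char_eq_one_iff
      have h3 := (this 1).1 (by rw [h1]; simp)
      exact one_ne_zero h3
    exact AddChar.sum_eq_zero_of_ne_one hφ

lemma sum_stdChar_dot' (x : ι → ZMod p) :
    ∑ ξ : ι → ZMod p, stdChar p (x ⬝ᵥ ξ) =
      if x = 0 then (Fintype.card (ι → ZMod p) : ℂ) else 0 := by
  simp_rw [dotProduct_comm x]; exact sum_stdChar_dot x

/-- The Fourier coefficient of `g` at the frequency `ξ`. -/
noncomputable def vecFourier (g : (ι → ZMod p) → ℂ) (ξ : ι → ZMod p) : ℂ :=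
  (Fintype.card (ι → ZMod p) : ℂ)⁻¹ * ∑ x, g x * stdChar p (-(ξ ⬝ᵥ x))

/-- The average of `∏ g (vᵢ)` over the solutions `v` of the two example equations, parametrized by
`(v₂, v₃, v₅)`. -/
noncomputable def exampleAvg (g : (ι → ZMod p) → ℂ) : ℂ :=
  ((Fintype.card (ι → ZMod p) : ℂ) ^ 3)⁻¹ * ∑ y, ∑ w, ∑ u,
    g (w + 2 * u - 2 * y) * g y * g w * g (2 * w + 2 * u - 3 * y) * g u

lemma card_ne_zero_complex : (Fintype.card (ι → ZMod p) : ℂ) ≠ 0 := by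
  simp [Fact.out (p := p.Prime) |>.ne_zero]

lemma vecFourier_zero (g : (ι → ZMod p) → ℂ) :
    vecFourier g 0 = (Fintype.card (ι → ZMod p) : ℂ)⁻¹ * ∑ x, g x := by
  simp [vecFourier]

lemma vecFourier_const_add (α ε : ℂ) (g : (ι → ZMod p) → ℂ) (ξ : ι → ZMod p) :
    vecFourier (fun x => α + ε * g x) ξ = (if ξ = 0 then α else 0) + ε * vecFourier g ξ := by
  have h : ∑ x : ι → ZMod p, stdChar p (-(ξ ⬝ᵥ x)) =
      if ξ = 0 then (Fintype.card (ι → ZMod p) : ℂ) else 0 := by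
    have := sum_stdChar_dot' (p := p) (-ξ)
    simpa only [neg_dotProduct, neg_eq_zero] using this
  simp only [vecFourier, add_mul, Finset.sum_add_distrib, mul_add, ← Finset.mul_sum, h, mul_assoc]
  congr 1
  · split_ifs
    · rw [mul_comm α, inv_mul_cancel_left₀ card_ne_zero_complex]
    · simp
  · ring

lemma vecFourier_neg (f : (ι → ZMod p) → ℝ) (ξ : ι → ZMod p) :
    vecFourier (fun x => (f x : ℂ)) (-ξ) =
      (starRingEnd ℂ) (vecFourier (fun x => (f x : ℂ)) ξ) := by
  simp [vecFourier, star_stdChar]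

lemma fourier_inversion (g : (ι → ZMod p) → ℂ) (x : ι → ZMod p) :
    g x = ∑ ξ, vecFourier g ξ * stdChar p (ξ ⬝ᵥ x) := by
  simp only [vecFourier, mul_assoc, Finset.sum_mul, ← Finset.mul_sum]
  rw [Finset.sum_comm]
  have h : ∀ z : ι → ZMod p, ∑ ξ : ι → ZMod p,
      g z * (stdChar p (-(ξ ⬝ᵥ z)) * stdChar p (ξ ⬝ᵥ x)) =
      if z = x then g x * (Fintype.card (ι → ZMod p) : ℂ) else 0 := by
    intro z
    rw [← Finset.mul_sum]
    simp_rw [← AddChar.map_add_eq_mul, neg_add_eq_sub, ← dotProduct_sub]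
    rw [sum_stdChar_dot]
    by_cases hz : z = x
    · simp [hz]
    · rw [if_neg (fun h => hz (sub_eq_zero.mp h).symm), if_neg hz, mul_zero]
  simp_rw [h]
  simp only [Finset.sum_ite_eq', Finset.mem_univ, if_true]
  rw [mul_comm (g x), inv_mul_cancel_left₀ card_ne_zero_complex]

lemma prod_five_sums {X : Type*} [Fintype X] (A B C D E : X → ℂ) :
    (∑ x, A x) * (∑ y, B y) * (∑ w, C w) * (∑ v, D v) * (∑ u, E u) =
      ∑ t : (X × X × X) × X × X,
        A t.2.1 * B t.1.1 * C t.1.2.1 * D t.2.2 * E t.1.2.2 := by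
  simp only [Fintype.sum_prod_type, ← Finset.mul_sum, ← Finset.sum_mul]

/-- Expand the five coefficients as sums over x, y, w, v, u. Orthogonality in a and in b then
enforces one defining equation each, which determines v and x from y, w, u. -/
lemma exampleAvg_eq_fourier (g : (ι → ZMod p) → ℂ) :
    exampleAvg g = ∑ a, ∑ b, vecFourier g (a + b) * vecFourier g (2 * b - a) *
      vecFourier g (a - b) * vecFourier g (-a) * vecFourier g (-2 * b) := by
  set N : ℂ := (Fintype.card (ι → ZMod p) : ℂ) with hN
  have hN0 : N ≠ 0 := card_ne_zero_complex
  have hphase : ∀ a b x y w v u : ι → ZMod p,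
      stdChar p (-((a + b) ⬝ᵥ x)) * stdChar p (-((2 * b - a) ⬝ᵥ y)) *
      stdChar p (-((a - b) ⬝ᵥ w)) * stdChar p (-((-a) ⬝ᵥ v)) *
      stdChar p (-((-2 * b) ⬝ᵥ u)) =
      stdChar p (a ⬝ᵥ (v - (x - y + w))) * stdChar p (b ⬝ᵥ (w + 2 * u - 2 * y - x)) := by
    intro a b x y w v u
    simp only [← AddChar.map_add_eq_mul]
    congr 1
    simp only [dotProduct, ← Finset.sum_neg_distrib, ← Finset.sum_add_distrib]
    refine Finset.sum_congr rfl fun i _ => ?_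
    simp
    ring
  have expand : ∀ a b : ι → ZMod p, vecFourier g (a + b) * vecFourier g (2 * b - a) *
      vecFourier g (a - b) * vecFourier g (-a) * vecFourier g (-2 * b) =
      (N ^ 5)⁻¹ * ∑ t : ((ι → ZMod p) × (ι → ZMod p) × (ι → ZMod p)) × (ι → ZMod p) × (ι → ZMod p),
        g t.2.1 * g t.1.1 * g t.1.2.1 * g t.2.2 * g t.1.2.2 *
        (stdChar p (a ⬝ᵥ (t.2.2 - (t.2.1 - t.1.1 + t.1.2.1))) *
          stdChar p (b ⬝ᵥ (t.1.2.1 + 2 * t.1.2.2 - 2 * t.1.1 - t.2.1))) := by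
    intro a b
    simp only [vecFourier, ← hN]
    have e1 : ∀ A B C D E : ℂ, N⁻¹ * A * (N⁻¹ * B) * (N⁻¹ * C) * (N⁻¹ * D) * (N⁻¹ * E) =
        (N ^ 5)⁻¹ * (A * B * C * D * E) := by
      intros; field_simp
    rw [e1, prod_five_sums]
    congr 1
    refine Finset.sum_congr rfl fun t _ => ?_
    rw [← hphase]
    ring
  simp only [expand, ← Finset.mul_sum]
  rw [← Fintype.sum_prod_type', Finset.sum_comm]
  simp only [← Finset.mul_sum]
  have inner : ∀ z z' : ι → ZMod p,
      ∑ q : (ι → ZMod p) × (ι → ZMod p), stdChar p (q.1 ⬝ᵥ z) * stdChar p (q.2 ⬝ᵥ z') =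
      (if z = 0 then N else 0) * (if z' = 0 then N else 0) := by
    intro z z'
    rw [Fintype.sum_prod_type]
    dsimp only
    rw [← Finset.sum_mul_sum, sum_stdChar_dot, sum_stdChar_dot]
  simp only [inner, Fintype.sum_prod_type]
  have collapse : ∀ y w u : ι → ZMod p,
      ∑ x, ∑ v, g x * g y * g w * g v * g u *
        ((if v - (x - y + w) = 0 then N else 0) *
          (if w + 2 * u - 2 * y - x = 0 then N else 0)) =
      N ^ 2 * (g (w + 2 * u - 2 * y) * g y * g w * g (2 * w + 2 * u - 3 * y) * g u) := by
    intro y w u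
    rw [Finset.sum_eq_single (w + 2 * u - 2 * y) _ (by simp)]
    · rw [Finset.sum_eq_single (2 * w + 2 * u - 3 * y) _ (by simp)]
      · rw [if_pos (by ring), if_pos (by ring)]
        ring
      · intro v _ hv
        rw [if_neg]
        · simp
        · intro h
          exact hv (by linear_combination h)
    · intro x _ hx
      refine Finset.sum_eq_zero fun v _ => ?_
      have : ¬ (w + 2 * u - 2 * y - x = 0) := fun h => hx (by linear_combination -h)
      simp [this]
  simp only [collapse, ← Finset.mul_sum, exampleAvg, ← hN]
  rw [← mul_assoc]
  congr 1
  field_simp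

end Fourier

/-! ### Expansion around a constant, and positivity of the quartic term. -/

section Expansion

variable {p : ℕ} [Fact p.Prime] {ι : Type*}

lemma zmod_two_ne_zero (hp2 : p ≠ 2) : (2 : ZMod p) ≠ 0 := by
  intro h
  have h' : ((2 : ℕ) : ZMod p) = 0 := by exact_mod_cast h
  rw [ZMod.natCast_eq_zero_iff] at h'
  exact hp2 ((Nat.prime_dvd_prime_iff_eq Fact.out Nat.prime_two).1 h')

lemma zmod_three_ne_zero (hp3 : p ≠ 3) : (3 : ZMod p) ≠ 0 := by
  intro h
  have h' : ((3 : ℕ) : ZMod p) = 0 := by exact_mod_cast h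
  rw [ZMod.natCast_eq_zero_iff] at h'
  exact hp3 ((Nat.prime_dvd_prime_iff_eq Fact.out Nat.prime_three).1 h')

lemma two_mul_vec_eq_zero (hp2 : p ≠ 2) {x : ι → ZMod p} : 2 * x = 0 ↔ x = 0 := by
  refine ⟨fun h => funext fun i => ?_, fun h => by simp [h]⟩
  have := congrFun h i
  simpa [zmod_two_ne_zero hp2] using this

lemma three_mul_vec_eq_zero (hp3 : p ≠ 3) {x : ι → ZMod p} : 3 * x = 0 ↔ x = 0 := by
  refine ⟨fun h => funext fun i => ?_, fun h => by simp [h]⟩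
  have := congrFun h i
  simpa [zmod_three_ne_zero hp3] using this

variable [Fintype ι]

lemma two_mul_vec_bijective (hp2 : p ≠ 2) :
    Function.Bijective (fun x : ι → ZMod p => 2 * x) :=
  Finite.injective_iff_bijective.1 fun x y h =>
    sub_eq_zero.1 ((two_mul_vec_eq_zero hp2).1 (by linear_combination h))

lemma three_mul_vec_bijective (hp3 : p ≠ 3) :
    Function.Bijective (fun x : ι → ZMod p => 3 * x) :=
  Finite.injective_iff_bijective.1 fun x y h =>
    sub_eq_zero.1 ((three_mul_vec_eq_zero hp3).1 (by linear_combination h))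

/-- A factor contributes α only where its frequency vanishes. Away from a = b = 0 at most one does,
and there `hF` kills the corresponding F. At the origin `hF` leaves only α^5. -/
lemma prod_expansion (hp2 : p ≠ 2) (hp3 : p ≠ 3) (F : (ι → ZMod p) → ℂ) (hF : F 0 = 0)
    (α ε : ℂ) (a b : ι → ZMod p) :
    ((if a + b = 0 then α else 0) + ε * F (a + b)) *
    ((if 2 * b - a = 0 then α else 0) + ε * F (2 * b - a)) *
    ((if a - b = 0 then α else 0) + ε * F (a - b)) *
    ((if -a = 0 then α else 0) + ε * F (-a)) *
    ((if -2 * b = 0 then α else 0) + ε * F (-2 * b)) =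
    (if a = 0 then if b = 0 then α ^ 5 else 0 else 0) +
    α * ε ^ 4 * (
      (if a = -b then F (2 * b - a) * F (a - b) * F (-a) * F (-2 * b) else 0) +
      (if a = 2 * b then F (a + b) * F (a - b) * F (-a) * F (-2 * b) else 0) +
      (if a = b then F (a + b) * F (2 * b - a) * F (-a) * F (-2 * b) else 0) +
      (if a = 0 then F (a + b) * F (2 * b - a) * F (a - b) * F (-2 * b) else 0) +
      (if b = 0 then F (a + b) * F (2 * b - a) * F (a - b) * F (-a) else 0)) +
    ε ^ 5 * (F (a + b) * F (2 * b - a) * F (a - b) * F (-a) * F (-2 * b)) := by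
  have h1 : a + b = 0 ↔ a = -b := add_eq_zero_iff_eq_neg
  have h2 : 2 * b - a = 0 ↔ a = 2 * b := by rw [sub_eq_zero, eq_comm]
  have h3 : a - b = 0 ↔ a = b := sub_eq_zero
  have h4 : -a = 0 ↔ a = 0 := neg_eq_zero
  have h5 : -2 * b = 0 ↔ b = 0 := by
    rw [neg_mul, neg_eq_zero, two_mul_vec_eq_zero hp2]
  simp only [h1, h2, h3, h4, h5]
  have two : ∀ x : ι → ZMod p, 2 * x = 0 → x = 0 := fun x => (two_mul_vec_eq_zero hp2).1
  have three : ∀ x : ι → ZMod p, 3 * x = 0 → x = 0 := fun x => (three_mul_vec_eq_zero hp3).1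
  by_cases hb : b = 0
  · subst hb
    by_cases ha : a = 0
    · subst ha
      simp [hF]
      ring
    · simp [ha, hF]
      ring
  · have n1 : ¬ (-b = 2 * b) := fun h => hb (three _ (by linear_combination -h))
    have n2 : ¬ (-b = b) := fun h => hb (two _ (by linear_combination -h))
    have n3 : ¬ (2 * b = b) := fun h => hb (by linear_combination h)
    have n4 : ¬ (2 * b = 0) := fun h => hb (two _ h)
    have n5 : ¬ (-b = 0) := fun h => hb (neg_eq_zero.1 h)
    by_cases c1 : a = -b
    · rw [c1]
      simp only [n1, n2, n5, hb, if_true, if_false, neg_add_cancel, hF]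
      ring
    by_cases c2 : a = 2 * b
    · have n1' : ¬ (2 * b = -b) := fun h => n1 h.symm
      rw [c2]
      simp only [n1', n3, n4, hb, if_true, if_false, sub_self, hF]
      ring
    by_cases c3 : a = b
    · have n2' : ¬ (b = -b) := fun h => n2 h.symm
      have n3' : ¬ (b = 2 * b) := fun h => n3 h.symm
      rw [c3]
      simp only [n2', n3', hb, if_true, if_false, sub_self, hF]
      ring
    by_cases c4 : a = 0
    · have n4' : ¬ (0 = 2 * b) := fun h => n4 h.symm
      have n5' : ¬ (0 = -b) := fun h => n5 h.symm
      have n6' : ¬ (0 = b) := fun h => hb h.symm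
      rw [c4]
      simp only [n4', n5', n6', hb, if_true, if_false, neg_zero, hF]
      ring
    · simp only [c1, c2, c3, c4, hb, if_false]
      ring

variable [DecidableEq ι]

/-- The sum of the five averages of a product of four factors `g (vᵢ)`, in terms of Fourier
coefficients. -/
noncomputable def quarticPart (g : (ι → ZMod p) → ℂ) : ℂ :=
  ∑ ξ, (vecFourier g ξ * vecFourier g ξ * vecFourier g (-ξ) * vecFourier g (-ξ) +
    2 * (vecFourier g ξ * vecFourier g (2 * ξ) * vecFourier g (-ξ) * vecFourier g (-2 * ξ)) +
    2 * (vecFourier g (3 * ξ) * vecFourier g ξ * vecFourier g (-2 * ξ) * vecFourier g (-2 * ξ)))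

lemma exampleAvg_const_add (hp2 : p ≠ 2) (hp3 : p ≠ 3) (g : (ι → ZMod p) → ℂ)
    (hg : vecFourier g 0 = 0) (α ε : ℂ) :
    exampleAvg (fun x => α + ε * g x) =
      α ^ 5 + α * ε ^ 4 * quarticPart g + ε ^ 5 * exampleAvg g := by
  rw [exampleAvg_eq_fourier (fun x => α + ε * g x)]
  simp only [vecFourier_const_add, prod_expansion hp2 hp3 _ hg, Finset.sum_add_distrib,
    ← Finset.mul_sum]
  rw [← exampleAvg_eq_fourier g]
  congr 3
  · simp
  · have hcollapse : ∀ (φ : (ι → ZMod p) → ι → ZMod p) (H : (ι → ZMod p) → (ι → ZMod p) → ℂ),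
        ∑ a, ∑ b, (if a = φ b then H a b else 0) = ∑ b, H (φ b) b := by
      intro φ H
      rw [Finset.sum_comm]
      simp
    rw [hcollapse (fun b => -b), hcollapse (fun b => 2 * b), hcollapse (fun b => b),
      hcollapse (fun b => 0)]
    simp only [Finset.sum_ite_eq', Finset.mem_univ, if_true, quarticPart,
      ← Finset.sum_add_distrib]
    refine Finset.sum_congr rfl fun ξ _ => ?_
    have e1 : 2 * ξ - -ξ = 3 * ξ := by ring
    have e2 : -ξ - ξ = -2 * ξ := by ring
    have e3 : 2 * ξ + ξ = 3 * ξ := by ring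
    have e4 : 2 * ξ - ξ = ξ := by ring
    have e5 : -(2 * ξ) = -2 * ξ := by ring
    have e6 : ξ + ξ = 2 * ξ := by ring
    simp only [e1, e2, e3, e4, e5, e6, neg_neg, zero_add, zero_sub, sub_zero, add_zero, mul_zero]
    ring

/-- For real f the first two summands are |F(ξ)|^4 and 2|F(ξ)|^2|F(2ξ)|^2. Only the third can be
negative; it is absorbed pointwise, with errors at 2ξ and 3ξ that become the same fourth-power sum
after summation, since dilations by 2 and 3 permute the frequencies. -/
lemma re_quarticPart_ge (hp2 : p ≠ 2) (hp3 : p ≠ 3) (f : (ι → ZMod p) → ℝ) :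
    (∑ ξ, ‖vecFourier (fun x => (f x : ℂ)) ξ‖ ^ 4) / 2 ≤
      (quarticPart (fun x => (f x : ℂ))).re := by
  set F := vecFourier (fun x => (f x : ℂ)) with hF
  have hneg : ∀ ξ, F (-ξ) = (starRingEnd ℂ) (F ξ) := vecFourier_neg f
  have hneg2 : ∀ ξ, F (-2 * ξ) = (starRingEnd ℂ) (F (2 * ξ)) := by
    intro ξ; rw [neg_mul, hneg]
  have h2 : ∑ ξ, ‖F (2 * ξ)‖ ^ 4 = ∑ ξ, ‖F ξ‖ ^ 4 :=
    Fintype.sum_bijective _ (two_mul_vec_bijective hp2) _ _ fun _ => rfl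
  have h3 : ∑ ξ, ‖F (3 * ξ)‖ ^ 4 = ∑ ξ, ‖F ξ‖ ^ 4 :=
    Fintype.sum_bijective _ (three_mul_vec_bijective hp3) _ _ fun _ => rfl
  have pointwise : ∀ ξ, ‖F ξ‖ ^ 4 - (‖F (3 * ξ)‖ ^ 4 + ‖F (2 * ξ)‖ ^ 4) / 4 ≤
      (F ξ * F ξ * F (-ξ) * F (-ξ) + 2 * (F ξ * F (2 * ξ) * F (-ξ) * F (-2 * ξ)) +
        2 * (F (3 * ξ) * F ξ * F (-2 * ξ) * F (-2 * ξ))).re := by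
    intro ξ
    have a1 : F ξ * F ξ * F (-ξ) * F (-ξ) = ((‖F ξ‖ ^ 4 : ℝ) : ℂ) := by
      rw [hneg, show F ξ * F ξ * (starRingEnd ℂ) (F ξ) * (starRingEnd ℂ) (F ξ) =
        (F ξ * (starRingEnd ℂ) (F ξ)) ^ 2 by ring, Complex.mul_conj']
      push_cast; ring
    have a2 : F ξ * F (2 * ξ) * F (-ξ) * F (-2 * ξ) =
        ((‖F ξ‖ ^ 2 * ‖F (2 * ξ)‖ ^ 2 : ℝ) : ℂ) := by
      rw [hneg, hneg2, show F ξ * F (2 * ξ) * (starRingEnd ℂ) (F ξ) * (starRingEnd ℂ) (F (2 * ξ)) =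
        (F ξ * (starRingEnd ℂ) (F ξ)) * (F (2 * ξ) * (starRingEnd ℂ) (F (2 * ξ))) by ring,
        Complex.mul_conj', Complex.mul_conj']
      push_cast; ring
    have a3 : -(‖F (3 * ξ)‖ * ‖F ξ‖ * ‖F (2 * ξ)‖ ^ 2) ≤
        (F (3 * ξ) * F ξ * F (-2 * ξ) * F (-2 * ξ)).re := by
      have := (abs_le.1 (Complex.abs_re_le_norm (F (3 * ξ) * F ξ * F (-2 * ξ) * F (-2 * ξ)))).1
      rw [hneg2] at this ⊢
      simp only [norm_mul, RCLike.norm_conj] at this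
      calc _ = -(‖F (3 * ξ)‖ * ‖F ξ‖ * ‖F (2 * ξ)‖ * ‖F (2 * ξ)‖) := by ring
        _ ≤ _ := this
    rw [a1, a2]
    generalize F (3 * ξ) * F ξ * F (-2 * ξ) * F (-2 * ξ) = z at a3 ⊢
    simp only [Complex.add_re, Complex.ofReal_re, Complex.mul_re, Complex.re_ofNat,
      Complex.im_ofNat, Complex.ofReal_im, zero_mul, sub_zero]
    -- With x, y, z the norms at ξ, 2ξ, 3ξ: 2x²y² - 2zxy² ≥ -z²y²/2 ≥ -(z⁴ + y⁴)/4.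
    nlinarith [sq_nonneg (2 * ‖F ξ‖ * ‖F (2 * ξ)‖ - ‖F (3 * ξ)‖ * ‖F (2 * ξ)‖),
      sq_nonneg (‖F (3 * ξ)‖ ^ 2 - ‖F (2 * ξ)‖ ^ 2)]
  have := Finset.sum_le_sum fun ξ (_ : ξ ∈ Finset.univ) => pointwise ξ
  rw [Finset.sum_sub_distrib, ← Finset.sum_div, Finset.sum_add_distrib, h2, h3] at this
  rw [quarticPart, Complex.re_sum]
  linarith

lemma norm_quarticPart_le (g : (ι → ZMod p) → ℂ) (B : ℝ)
    (hB : ∀ ξ, ‖vecFourier g ξ‖ ≤ B) :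
    ‖quarticPart g‖ ≤ 5 * Fintype.card (ι → ZMod p) * B ^ 4 := by
  have hB0 : 0 ≤ B := (norm_nonneg _).trans (hB 0)
  have hprod : ∀ a b c d, ‖vecFourier g a * vecFourier g b * vecFourier g c * vecFourier g d‖ ≤
      B ^ 4 := by
    intro a b c d
    simp only [norm_mul]
    calc _ ≤ B * B * B * B := by gcongr <;> apply hB
      _ = B ^ 4 := by ring
  calc ‖quarticPart g‖ ≤ ∑ _ξ : ι → ZMod p, 5 * B ^ 4 := by
        refine norm_sum_le_of_le _ fun ξ _ => ?_
        refine (norm_add₃_le).trans ?_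
        rw [norm_mul 2, norm_mul 2, Complex.norm_ofNat]
        linarith [hprod ξ ξ (-ξ) (-ξ), hprod ξ (2 * ξ) (-ξ) (-2 * ξ),
          hprod (3 * ξ) ξ (-2 * ξ) (-2 * ξ)]
    _ = _ := by simp; ring

end Expansion

/-! ### The split quadric and the counterexample. -/

section Hyperbolic

variable {p : ℕ} [Fact p.Prime] {m : ℕ}

/-- The hyperbolic quadratic form `(x, y) ↦ x ⬝ y` on `𝔽_p^m × 𝔽_p^m`. -/
def hyperbolicForm (x : Fin m ⊕ Fin m → ZMod p) : ZMod p :=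
  (x ∘ Sum.inl) ⬝ᵥ (x ∘ Sum.inr)

/-- The normalized indicator function of the quadric `x ⬝ y = 0`, minus one. -/
noncomputable def quadricFun (x : Fin m ⊕ Fin m → ZMod p) : ℝ :=
  if hyperbolicForm x = 0 then (p : ℝ) - 1 else -1

lemma sum_units_eq (φ : ZMod p → ℂ) : ∑ c : (ZMod p)ˣ, φ c = (∑ c, φ c) - φ 0 := by
  rw [Fintype.sum_eq_add_sum_subtype_ne φ 0, add_sub_cancel_left]
  exact Fintype.sum_equiv unitsEquivNeZero _ _ fun _ => rfl

lemma quadricFun_eq_sum (x : Fin m ⊕ Fin m → ZMod p) :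
    (quadricFun x : ℂ) = ∑ c : (ZMod p)ˣ, stdChar p (c * hyperbolicForm x) := by
  rw [sum_units_eq (fun c => stdChar p (c * hyperbolicForm x)),
    AddChar.sum_mulShift _ stdChar_isPrimitive, ZMod.card, quadricFun]
  split_ifs <;> simp

lemma sum_hyperbolic_pairs (H : (Fin m ⊕ Fin m → ZMod p) → ℂ) :
    ∑ x, H x = ∑ l : Fin m → ZMod p, ∑ r : Fin m → ZMod p, H (Sum.elim l r) := by
  rw [← Fintype.sum_prod_type']
  exact (Fintype.sum_equiv (Equiv.sumArrowEquivProdArrow (Fin m) (Fin m) (ZMod p)).symm _ _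
    fun _ => rfl).symm

lemma card_sum_fun : (Fintype.card (Fin m ⊕ Fin m → ZMod p) : ℝ) = ((p : ℝ) ^ m) ^ 2 := by
  simp [ZMod.card, pow_add, sq]

/-- For each nonzero c, summing over the right half fixes the left half, leaving one unimodular term
times p^m. There are fewer than p values of c, and the normalization is p^(-2m). -/
lemma norm_vecFourier_quadricFun_le (ξ : Fin m ⊕ Fin m → ZMod p) :
    ‖vecFourier (fun x => (quadricFun x : ℂ)) ξ‖ ≤ p / (p : ℝ) ^ m := by
  have hp0 : (0 : ℝ) < p := by exact_mod_cast (Fact.out (p := p.Prime)).pos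
  have key : ∀ c : (ZMod p)ˣ, ‖∑ x : Fin m ⊕ Fin m → ZMod p,
      stdChar p (c * hyperbolicForm x) * stdChar p (-(ξ ⬝ᵥ x))‖ ≤ (p : ℝ) ^ m := by
    intro c
    rw [sum_hyperbolic_pairs]
    have h1 : ∀ l r : Fin m → ZMod p,
        stdChar p (c * hyperbolicForm (Sum.elim l r)) * stdChar p (-(ξ ⬝ᵥ Sum.elim l r)) =
        stdChar p (-((ξ ∘ Sum.inl) ⬝ᵥ l)) *
          stdChar p (((c : ZMod p) • l - ξ ∘ Sum.inr) ⬝ᵥ r) := by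
      intro l r
      simp only [← AddChar.map_add_eq_mul]
      congr 1
      simp [hyperbolicForm, dotProduct, Finset.mul_sum, sub_mul, mul_assoc, Fintype.sum_sum_type]
      ring
    simp only [h1, ← Finset.mul_sum, sum_stdChar_dot']
    have h2 : ∀ l : Fin m → ZMod p, (c : ZMod p) • l - ξ ∘ Sum.inr = 0 ↔
        l = (c⁻¹ : (ZMod p)ˣ) • (ξ ∘ Sum.inr) := by
      intro l
      rw [sub_eq_zero, eq_inv_smul_iff]
      rfl
    simp only [h2, mul_ite, mul_zero, Finset.sum_ite_eq', Finset.mem_univ, if_true, norm_mul,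
      stdChar_norm, one_mul]
    simp [ZMod.card]
  have hN : (0 : ℝ) < (p : ℝ) ^ m := by positivity
  rw [vecFourier, norm_mul, norm_inv, Complex.norm_natCast, card_sum_fun]
  simp only [quadricFun_eq_sum, Finset.sum_mul]
  rw [Finset.sum_comm]
  have h3 : ‖∑ c : (ZMod p)ˣ, ∑ x : Fin m ⊕ Fin m → ZMod p,
      stdChar p (c * hyperbolicForm x) * stdChar p (-(ξ ⬝ᵥ x))‖ ≤ p * (p : ℝ) ^ m := by
    refine (norm_sum_le_of_le _ fun c _ => key c).trans ?_
    simp only [Finset.sum_const, Finset.card_univ, nsmul_eq_mul]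
    gcongr
    rw [ZMod.card_units]
    exact Nat.sub_le _ _
  calc _ ≤ (((p : ℝ) ^ m) ^ 2)⁻¹ * (p * (p : ℝ) ^ m) := by gcongr
    _ = _ := by field_simp

/-- The exponential sum over the example variety with coefficients `c₁, …, c₅`. -/
noncomputable def varietySum (m : ℕ) (c₁ c₂ c₃ c₄ c₅ : ZMod p) : ℂ :=
  ∑ y : Fin m ⊕ Fin m → ZMod p, ∑ w, ∑ u,
    stdChar p (c₁ * hyperbolicForm (w + 2 * u - 2 * y) + c₂ * hyperbolicForm y +
      c₃ * hyperbolicForm w + c₄ * hyperbolicForm (2 * w + 2 * u - 3 * y) +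
      c₅ * hyperbolicForm u)

/-- Triples of vectors in a split space, as pairs of triples. -/
def tripleSplit (F : Type*) (m : ℕ) :
    ((Fin m → F) × (Fin m → F) × (Fin m → F)) × ((Fin m → F) × (Fin m → F) × (Fin m → F)) ≃
      (Fin m ⊕ Fin m → F) × (Fin m ⊕ Fin m → F) × (Fin m ⊕ Fin m → F) where
  toFun t := (Sum.elim t.1.1 t.2.1, Sum.elim t.1.2.1 t.2.2.1, Sum.elim t.1.2.2 t.2.2.2)
  invFun s := ((s.1 ∘ Sum.inl, s.2.1 ∘ Sum.inl, s.2.2 ∘ Sum.inl),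
    (s.1 ∘ Sum.inr, s.2.1 ∘ Sum.inr, s.2.2 ∘ Sum.inr))
  left_inv _ := by simp
  right_inv _ := by simp

/-- The phase is linear in the right halves of the vectors, so summing over these counts the left
halves in the kernel of the Gram matrix of the combined form. Using a split form thus makes every
such sum a nonnegative real, so none can cancel another. -/
lemma varietySum_eq (c₁ c₂ c₃ c₄ c₅ : ZMod p) :
    varietySum m c₁ c₂ c₃ c₄ c₅ =
      (((p : ℝ) ^ m) ^ 3 * ∑ y : Fin m → ZMod p, ∑ u, ∑ w,
        if (-2 * c₁) • (w + 2 * u - 2 * y) + c₂ • y + (-3 * c₄) • (2 * w + 2 * u - 3 * y) = 0 ∧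
          c₁ • (w + 2 * u - 2 * y) + c₃ • w + (2 * c₄) • (2 * w + 2 * u - 3 * y) = 0 ∧
          (2 * c₁) • (w + 2 * u - 2 * y) + (2 * c₄) • (2 * w + 2 * u - 3 * y) + c₅ • u = 0
        then 1 else 0 : ℝ) := by
  have hphase : ∀ y w u y' w' u' : Fin m → ZMod p,
      stdChar p (c₁ * hyperbolicForm
          (Sum.elim w w' + 2 * Sum.elim u u' - 2 * Sum.elim y y') +
        c₂ * hyperbolicForm (Sum.elim y y') + c₃ * hyperbolicForm (Sum.elim w w') +
        c₄ * hyperbolicForm (2 * Sum.elim w w' + 2 * Sum.elim u u' - 3 * Sum.elim y y') +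
        c₅ * hyperbolicForm (Sum.elim u u')) =
      stdChar p (((-2 * c₁) • (w + 2 * u - 2 * y) + c₂ • y +
        (-3 * c₄) • (2 * w + 2 * u - 3 * y)) ⬝ᵥ y') *
      (stdChar p ((c₁ • (w + 2 * u - 2 * y) + c₃ • w +
        (2 * c₄) • (2 * w + 2 * u - 3 * y)) ⬝ᵥ w') *
      stdChar p (((2 * c₁) • (w + 2 * u - 2 * y) + (2 * c₄) • (2 * w + 2 * u - 3 * y) +
        c₅ • u) ⬝ᵥ u')) := by
    intro y w u y' w' u'
    simp only [← AddChar.map_add_eq_mul]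
    congr 1
    simp only [hyperbolicForm, dotProduct, Finset.mul_sum, ← Finset.sum_add_distrib]
    refine Finset.sum_congr rfl fun i _ => ?_
    simp
    ring
  have hsplit : varietySum m c₁ c₂ c₃ c₄ c₅ =
      ∑ y : Fin m → ZMod p, ∑ w, ∑ u, ∑ y', ∑ w', ∑ u',
        stdChar p (c₁ * hyperbolicForm
          (Sum.elim w w' + 2 * Sum.elim u u' - 2 * Sum.elim y y') +
        c₂ * hyperbolicForm (Sum.elim y y') + c₃ * hyperbolicForm (Sum.elim w w') +
        c₄ * hyperbolicForm (2 * Sum.elim w w' + 2 * Sum.elim u u' - 3 * Sum.elim y y') +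
        c₅ * hyperbolicForm (Sum.elim u u')) := by
    simp only [varietySum, ← Fintype.sum_prod_type']
    rw [← (tripleSplit (ZMod p) m).sum_comp]
    simp only [Fintype.sum_prod_type]
    rfl
  rw [hsplit]
  simp only [hphase, ← Finset.mul_sum, ← Finset.sum_mul, sum_stdChar_dot']
  push_cast
  rw [Finset.mul_sum]
  refine Finset.sum_congr rfl fun y _ => ?_
  rw [Finset.sum_comm, Finset.mul_sum]
  refine Finset.sum_congr rfl fun u _ => ?_
  rw [Finset.mul_sum]
  refine Finset.sum_congr rfl fun w _ => ?_
  simp only [ite_and, Fintype.card_fun, ZMod.card, Fintype.card_fin, Nat.cast_pow]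
  split_ifs <;> simp
  ring

lemma re_varietySum_nonneg (c₁ c₂ c₃ c₄ c₅ : ZMod p) :
    0 ≤ (varietySum m c₁ c₂ c₃ c₄ c₅).re := by
  rw [varietySum_eq, Complex.ofReal_re]
  positivity

/-- The coefficients are chosen so that 36(w+2u-2y)² - 9y² + 4w² - 6(2w+2u-3y)² + 24u² =
(4w+12u-9y)². The kernel is then cut out by a single vector equation. -/
lemma re_varietySum_rank_one (hp2 : p ≠ 2) :
    ((p : ℝ) ^ m) ^ 5 ≤ (varietySum (p := p) m 36 (-9) 4 (-6) 24).re := by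
  rw [varietySum_eq, Complex.ofReal_re]
  have h4 : (4 : ZMod p) ≠ 0 := by
    have := zmod_two_ne_zero hp2
    rw [show (4 : ZMod p) = 2 * 2 by norm_num]
    exact mul_ne_zero this this
  have hsum : ∀ y u : Fin m → ZMod p, (1 : ℝ) ≤ ∑ w : Fin m → ZMod p,
      if (-2 * 36 : ZMod p) • (w + 2 * u - 2 * y) + (-9 : ZMod p) • y +
          (-3 * -6 : ZMod p) • (2 * w + 2 * u - 3 * y) = 0 ∧
        (36 : ZMod p) • (w + 2 * u - 2 * y) + (4 : ZMod p) • w +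
          (2 * -6 : ZMod p) • (2 * w + 2 * u - 3 * y) = 0 ∧
        (2 * 36 : ZMod p) • (w + 2 * u - 2 * y) +
          (2 * -6 : ZMod p) • (2 * w + 2 * u - 3 * y) + (24 : ZMod p) • u = 0
      then 1 else 0 := by
    intro y u
    -- The witness solves 4w + 12u - 9y = 0 for w.
    refine le_trans ?_ (Finset.single_le_sum (fun w _ => by positivity)
      (Finset.mem_univ ((4 : ZMod p)⁻¹ • (9 * y - 12 * u))))
    rw [if_pos]
    refine ⟨?_, ?_, ?_⟩ <;>
    · ext i
      simp
      field_simp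
      ring
  calc ((p : ℝ) ^ m) ^ 5 = ((p : ℝ) ^ m) ^ 3 * ∑ _y : Fin m → ZMod p, ∑ _u : Fin m → ZMod p, 1 := by
        simp [ZMod.card]; ring
    _ ≤ _ := by
        gcongr with y _ u _
        exact hsum y u

lemma exampleAvg_quadricFun_eq :
    exampleAvg (fun x : Fin m ⊕ Fin m → ZMod p => (quadricFun x : ℂ)) =
      ((((p : ℝ) ^ m) ^ 6)⁻¹ : ℝ) *
        ∑ t : ((ZMod p)ˣ × (ZMod p)ˣ × (ZMod p)ˣ) × (ZMod p)ˣ × (ZMod p)ˣ,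
          varietySum m (t.2.1 : ZMod p) t.1.1 t.1.2.1 t.2.2 t.1.2.2 := by
  rw [exampleAvg]
  congr 1
  · have := card_sum_fun (p := p) (m := m)
    rw [← Complex.ofReal_natCast, this]
    push_cast
    ring
  · simp only [quadricFun_eq_sum, prod_five_sums, ← AddChar.map_add_eq_mul, varietySum]
    symm
    rw [Finset.sum_comm]
    refine Finset.sum_congr rfl fun y _ => ?_
    rw [Finset.sum_comm]
    refine Finset.sum_congr rfl fun w _ => ?_
    rw [Finset.sum_comm]

/-- By nonnegativity all terms but the rank-one one may be dropped. Its coefficients are units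
because p is neither 2 nor 3. -/
lemma re_exampleAvg_quadricFun_ge (hp2 : p ≠ 2) (hp3 : p ≠ 3) :
    ((p : ℝ) ^ m)⁻¹ ≤
      (exampleAvg (fun x : Fin m ⊕ Fin m → ZMod p => (quadricFun x : ℂ))).re := by
  have hp0 : (0 : ℝ) < p := by exact_mod_cast (Fact.out (p := p.Prime)).pos
  have two := zmod_two_ne_zero hp2
  have three := zmod_three_ne_zero hp3
  have n36 : (36 : ZMod p) ≠ 0 := by
    rw [show (36 : ZMod p) = 2 ^ 2 * 3 ^ 2 by norm_num]; positivity
  have n9 : (-9 : ZMod p) ≠ 0 := by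
    rw [show (-9 : ZMod p) = -(3 ^ 2) by norm_num]; simpa using three
  have n4 : (4 : ZMod p) ≠ 0 := by
    rw [show (4 : ZMod p) = 2 ^ 2 by norm_num]; simpa using two
  have n6 : (-6 : ZMod p) ≠ 0 := by
    rw [show (-6 : ZMod p) = -(2 * 3) by norm_num]; simp [two, three]
  have n24 : (24 : ZMod p) ≠ 0 := by
    rw [show (24 : ZMod p) = 2 ^ 3 * 3 by norm_num]; simp [two, three]
  rw [exampleAvg_quadricFun_eq, Complex.re_ofReal_mul, Complex.re_sum]
  calc ((p : ℝ) ^ m)⁻¹ = (((p : ℝ) ^ m) ^ 6)⁻¹ * ((p : ℝ) ^ m) ^ 5 := by field_simp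
    _ ≤ _ := by
      gcongr
      refine (re_varietySum_rank_one hp2).trans ?_
      have := Finset.single_le_sum
        (f := fun t : ((ZMod p)ˣ × (ZMod p)ˣ × (ZMod p)ˣ) × (ZMod p)ˣ × (ZMod p)ˣ =>
          (varietySum m (t.2.1 : ZMod p) t.1.1 t.1.2.1 t.2.2 t.1.2.2).re)
        (fun t _ => re_varietySum_nonneg _ _ _ _ _)
        (Finset.mem_univ ((Units.mk0 (-9) n9, Units.mk0 4 n4, Units.mk0 24 n24),
          Units.mk0 36 n36, Units.mk0 (-6) n6))
      simpa only [Units.val_mk0] using this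

lemma abs_quadricFun_le (x : Fin m ⊕ Fin m → ZMod p) : |quadricFun x| ≤ (p : ℝ) - 1 := by
  have hp : (2 : ℝ) ≤ p := by exact_mod_cast (Fact.out (p := p.Prime)).two_le
  rw [quadricFun]
  split_ifs
  · rw [abs_of_nonneg (by linarith)]
  · rw [abs_neg, abs_one]; linarith

lemma exists_counterexample (hp2 : p ≠ 2) (hp3 : p ≠ 3) (ε : ℝ) (hε : 0 < ε) :
    ∃ m : ℕ, 1 ≤ m ∧ ∃ f : (Fin m ⊕ Fin m → ZMod p) → ℝ,
      (∀ x, |f x| ≤ 1 / 2) ∧ ∑ x, f x = 0 ∧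
      (exampleAvg (fun x => ((1 / 2 + ε * f x : ℝ) : ℂ))).re < (1 / 2) ^ 5 := by
  have hp : (2 : ℝ) ≤ p := by exact_mod_cast (Fact.out (p := p.Prime)).two_le
  set η : ℝ := ε / (2 * p) with hη
  have hη0 : 0 < η := by positivity
  -- The first summand makes the effect of the mean δ negligible against 1/M; the second makes η/M
  -- exceed the quartic bound 5p^4/M^2.
  obtain ⟨m, hm⟩ := pow_unbounded_of_one_lt (20 * (p : ℝ) ^ 5 + 5 * (p : ℝ) ^ 4 / η)
    (by linarith : (1 : ℝ) < p)
  set M : ℝ := (p : ℝ) ^ m with hM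
  have hq : 0 < 5 * (p : ℝ) ^ 4 / η := by positivity
  have hp5 : 1 ≤ (p : ℝ) ^ 5 := one_le_pow₀ (by linarith)
  have hM1 : 20 * (p : ℝ) ^ 5 ≤ M := by linarith
  have hM2 : 5 * (p : ℝ) ^ 4 < η * M := by
    have : 5 * (p : ℝ) ^ 4 / η < M := by linarith
    rw [div_lt_iff₀ hη0] at this
    linarith
  have hM20 : 20 ≤ M := by linarith
  have hM0 : 0 < M := by linarith
  have hm1 : 1 ≤ m := by
    rcases Nat.eq_zero_or_pos m with h | h
    · rw [hM, h, pow_zero] at hM20; norm_num at hM20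
    · exact h
  have hNR := card_sum_fun (p := p) (m := m)
  set N := Fintype.card (Fin m ⊕ Fin m → ZMod p) with hN
  have hN0 : (N : ℝ) ≠ 0 := by rw [hNR]; positivity
  set δ : ℝ := (N : ℝ)⁻¹ * ∑ x : Fin m ⊕ Fin m → ZMod p, quadricFun x with hδ
  have hδc : vecFourier (fun x : Fin m ⊕ Fin m → ZMod p => (quadricFun x : ℂ)) 0 = δ := by
    rw [vecFourier_zero, hδ]; push_cast; rfl
  have hδB : |δ| ≤ p / M := by
    have := norm_vecFourier_quadricFun_le (0 : Fin m ⊕ Fin m → ZMod p)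
    rwa [hδc, Complex.norm_real, Real.norm_eq_abs] at this
  have hδ1 : |δ| ≤ 1 := by
    refine hδB.trans ?_
    rw [div_le_one hM0]
    have : (p : ℝ) ≤ (p : ℝ) ^ 5 := le_self_pow₀ (by linarith) (by norm_num)
    linarith
  set G : (Fin m ⊕ Fin m → ZMod p) → ℂ := fun x => -δ + 1 * quadricFun x with hG
  have hG0 : vecFourier G 0 = 0 := by
    rw [hG, vecFourier_const_add, hδc]; simp
  have hGB : ∀ ξ, ‖vecFourier G ξ‖ ≤ p / M := by
    intro ξ
    by_cases hξ : ξ = 0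
    · rw [hξ, hG0, norm_zero]; positivity
    · rw [hG, vecFourier_const_add, if_neg hξ, zero_add, one_mul]
      exact norm_vecFourier_quadricFun_le ξ
  have hQ : ‖quarticPart G‖ ≤ 5 * p ^ 4 / M ^ 2 := by
    refine (norm_quarticPart_le G _ hGB).trans (le_of_eq ?_)
    rw [← hN, hNR, ← hM]
    field_simp
  have hT : 1 / (2 * M) ≤ (exampleAvg G).re := by
    have h1 := re_exampleAvg_quadricFun_ge (m := m) hp2 hp3
    -- Expanding q = δ + G gives T(q) = δ^5 + δ Q(G) + T(G), and the first two terms are at most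
    -- 1/(4M) each.
    have h2 : (fun x : Fin m ⊕ Fin m → ZMod p => (quadricFun x : ℂ)) =
        fun x => (δ : ℂ) + 1 * G x := by
      ext x; simp [hG]
    rw [h2, exampleAvg_const_add hp2 hp3 G hG0] at h1
    simp only [one_pow, mul_one, one_mul, Complex.add_re, Complex.re_ofReal_mul,
      ← Complex.ofReal_pow, Complex.ofReal_re] at h1
    have h3 : δ ^ 5 ≤ (p / M) ^ 5 := by
      calc δ ^ 5 ≤ |δ ^ 5| := le_abs_self _
        _ = |δ| ^ 5 := abs_pow _ _
        _ ≤ _ := by gcongr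
    have h4 : δ * (quarticPart G).re ≤ p / M * (5 * p ^ 4 / M ^ 2) := by
      calc _ ≤ |δ * (quarticPart G).re| := le_abs_self _
        _ = |δ| * |(quarticPart G).re| := abs_mul _ _
        _ ≤ _ := by
          gcongr
          exact (Complex.abs_re_le_norm _).trans hQ
    have h5 : (p / M) ^ 5 ≤ 1 / (4 * M) := by
      rw [div_pow, div_le_div_iff₀ (by positivity) (by positivity)]
      have e2 : M * M ≤ 1 * M ^ 5 := by
        have : 1 ≤ M ^ 3 := one_le_pow₀ (by linarith)
        nlinarith [mul_pos hM0 hM0]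
      nlinarith
    have h6 : p / M * (5 * p ^ 4 / M ^ 2) ≤ 1 / (4 * M) := by
      rw [div_mul_div_comm, div_le_div_iff₀ (by positivity) (by positivity)]
      have e2 : M * M ≤ M ^ 3 := by nlinarith [mul_pos hM0 hM0]
      nlinarith
    have h7 : M⁻¹ = 1 / (2 * M) + 1 / (4 * M) + 1 / (4 * M) := by field_simp; norm_num
    linarith
  -- The sign makes the fifth-order term negative; division by 2p gives the bound 1/2, as |q| ≤ p -
  -- 1 and |δ| ≤ 1.
  refine ⟨m, hm1, fun x => -(quadricFun x - δ) / (2 * p), ?_, ?_, ?_⟩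
  · intro x
    rw [abs_div, abs_neg, abs_of_pos (by linarith : (0 : ℝ) < 2 * p),
      div_le_div_iff₀ (by linarith) (by norm_num)]
    have := abs_sub (quadricFun x) δ
    have := abs_quadricFun_le x
    linarith
  · rw [← Finset.sum_div, Finset.sum_neg_distrib, Finset.sum_sub_distrib, Finset.sum_const,
      Finset.card_univ, ← hN, nsmul_eq_mul, hδ, mul_inv_cancel_left₀ hN0]
    simp
  · have h1 : (fun x : Fin m ⊕ Fin m → ZMod p =>
        ((1 / 2 + ε * (-(quadricFun x - δ) / (2 * p)) : ℝ) : ℂ)) =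
        fun x => ((1 / 2 : ℝ) : ℂ) + ((-η : ℝ) : ℂ) * G x := by
      ext x
      simp only [hG, hη]
      push_cast
      ring
    rw [h1, exampleAvg_const_add hp2 hp3 G hG0]
    simp only [← Complex.ofReal_pow, ← Complex.ofReal_mul, Complex.add_re, Complex.re_ofReal_mul,
      Complex.ofReal_re]
    have h2 : (quarticPart G).re ≤ 5 * p ^ 4 / M ^ 2 :=
      (Complex.re_le_norm _).trans hQ
    have h3 : 5 * p ^ 4 / M ^ 2 < η / M := by
      rw [div_lt_div_iff₀ (by positivity) hM0]
      nlinarith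
    have h4 : η / M ≤ 2 * (η * (exampleAvg G).re) := by
      calc η / M = 2 * (η * (1 / (2 * M))) := by field_simp
        _ ≤ _ := by gcongr
    have h5 : 0 < η ^ 4 := by positivity
    nlinarith

end Hyperbolic

/-! ### Systems of forms defined by the example equations. -/

namespace FormSystem

variable {p : ℕ} [Fact p.Prime] {D : ℕ} {Ψ : FormSystem p D 5}

lemma mem_ker_exampleMatrix (v : Fin 5 → ZMod p) :
    v ∈ LinearMap.ker (exampleMatrix p).mulVecLin ↔
      v 0 = v 2 + 2 * v 4 - 2 * v 1 ∧ v 3 = 2 * v 2 + 2 * v 4 - 3 * v 1 := by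
  rw [LinearMap.mem_ker, Matrix.mulVecLin_apply, funext_iff, Fin.forall_fin_two]
  simp [exampleMatrix, Matrix.mulVec, dotProduct, Fin.sum_univ_five]
  constructor
  · rintro ⟨h1, h2⟩
    exact ⟨by linear_combination h2, by linear_combination h2 - h1⟩
  · rintro ⟨h1, h2⟩
    exact ⟨by linear_combination h1 - h2, by linear_combination h1⟩

lemma toMap_mem (h : Ψ.IsDefinedBy (exampleMatrix p)) (x : Fin D → ZMod p) :
    Ψ 0 x = Ψ 2 x + 2 * Ψ 4 x - 2 * Ψ 1 x ∧ Ψ 3 x = 2 * Ψ 2 x + 2 * Ψ 4 x - 3 * Ψ 1 x := by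
  have : Ψ.toMap x ∈ LinearMap.range Ψ.toMap := ⟨x, rfl⟩
  rw [h, mem_ker_exampleMatrix] at this
  exact this

lemma exists_preimage (h : Ψ.IsDefinedBy (exampleMatrix p)) (y w u : ZMod p) :
    ∃ x, Ψ 1 x = y ∧ Ψ 2 x = w ∧ Ψ 4 x = u := by
  have hv : ![w + 2 * u - 2 * y, y, w, 2 * w + 2 * u - 3 * y, u] ∈ LinearMap.range Ψ.toMap := by
    rw [h, mem_ker_exampleMatrix]
    exact ⟨rfl, rfl⟩
  obtain ⟨x, hx⟩ := hv
  exact ⟨x, congrFun hx 1, congrFun hx 2, congrFun hx 4⟩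

/-- Coordinates 1, 2, 4 determine the other two, so they parametrize the image, and nondegeneracy
makes the map to the image injective. Hence T does not depend on the choice of D and Ψ. -/
lemma induced_triple_bijective (hn : Ψ.Nondegenerate) (h : Ψ.IsDefinedBy (exampleMatrix p))
    (n : ℕ) : Function.Bijective (fun x : Fin D → Fin n → ZMod p =>
      (Ψ.induced 1 x, Ψ.induced 2 x, Ψ.induced 4 x)) := by
  constructor
  · intro x x' hx
    simp only [Prod.mk.injEq] at hx
    obtain ⟨h1, h2, h4⟩ := hx
    have hinj : Function.Injective Ψ.toMap := LinearMap.ker_eq_bot.1 hn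
    have hcol : ∀ k, (fun d => x d k) = fun d => x' d k := by
      intro k
      apply hinj
      have e1 : Ψ 1 (fun d => x d k) = Ψ 1 (fun d => x' d k) := congrFun h1 k
      have e2 : Ψ 2 (fun d => x d k) = Ψ 2 (fun d => x' d k) := congrFun h2 k
      have e4 : Ψ 4 (fun d => x d k) = Ψ 4 (fun d => x' d k) := congrFun h4 k
      have m := toMap_mem h (fun d => x d k)
      have m' := toMap_mem h (fun d => x' d k)
      funext i
      change Ψ i _ = Ψ i _
      fin_cases i
      · exact (m.1.trans (by rw [e1, e2, e4])).trans m'.1.symm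
      · exact e1
      · exact e2
      · exact (m.2.trans (by rw [e1, e2, e4])).trans m'.2.symm
      · exact e4
    funext d k
    exact congrFun (hcol k) d
  · rintro ⟨y, w, u⟩
    choose x hx using fun k => exists_preimage h (y k) (w k) (u k)
    refine ⟨fun d k => x k d, ?_⟩
    simp only [Prod.mk.injEq]
    exact ⟨funext fun k => (hx k).1, funext fun k => (hx k).2.1, funext fun k => (hx k).2.2⟩

lemma ofReal_T_eq_exampleAvg (hn : Ψ.Nondegenerate) (h : Ψ.IsDefinedBy (exampleMatrix p)) {n : ℕ}
    (f : (Fin n → ZMod p) → ℝ) : ((Ψ.T f : ℝ) : ℂ) = exampleAvg (fun x => (f x : ℂ)) := by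
  have h0 : ∀ x : Fin D → Fin n → ZMod p, Ψ.induced 0 x =
      Ψ.induced 2 x + 2 * Ψ.induced 4 x - 2 * Ψ.induced 1 x :=
    fun x => funext fun k => (toMap_mem h _).1
  have h3 : ∀ x : Fin D → Fin n → ZMod p, Ψ.induced 3 x =
      2 * Ψ.induced 2 x + 2 * Ψ.induced 4 x - 3 * Ψ.induced 1 x :=
    fun x => funext fun k => (toMap_mem h _).2
  have key : Ψ.T f = 𝔼 t : (Fin n → ZMod p) × (Fin n → ZMod p) × (Fin n → ZMod p),
      f (t.2.1 + 2 * t.2.2 - 2 * t.1) * f t.1 * f t.2.1 *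
        f (2 * t.2.1 + 2 * t.2.2 - 3 * t.1) * f t.2.2 := by
    refine Fintype.expect_bijective _ (induced_triple_bijective hn h n) _ _ fun x => ?_
    rw [Fin.prod_univ_five, h0, h3]
  rw [key, Fintype.expect_eq_sum_div_card, exampleAvg, Fintype.sum_prod_type]
  simp only [Fintype.sum_prod_type, Fintype.card_prod]
  push_cast
  rw [div_eq_inv_mul]
  congr 2
  ring

lemma exampleAvg_reindex {ι κ : Type*} [Fintype ι] [DecidableEq ι] [Fintype κ] [DecidableEq κ]
    (e : ι ≃ κ) (g : (ι → ZMod p) → ℂ) :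
    exampleAvg (fun x : κ → ZMod p => g (x ∘ e)) = exampleAvg g := by
  have hsum : ∀ H : (ι → ZMod p) → ℂ, ∑ x, H x = ∑ x : κ → ZMod p, H (x ∘ e) := fun H =>
    (Fintype.sum_equiv (e.arrowCongr (Equiv.refl (ZMod p))).symm _ _ fun _ => rfl).symm
  have hcard : Fintype.card (ι → ZMod p) = Fintype.card (κ → ZMod p) :=
    Fintype.card_congr (e.arrowCongr (Equiv.refl _))
  simp only [exampleAvg, hcard, hsum]
  rfl

lemma hasComplexity_one (hp2 : p ≠ 2) (h : Ψ.IsDefinedBy (exampleMatrix p)) :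
    Ψ.HasComplexity 1 := by
  refine ⟨⟨one_pos, ?_⟩, fun s hs => hs.1⟩
  rw [Fintype.linearIndependent_iff]
  intro c hc
  have two := zmod_two_ne_zero hp2
  have ev : ∀ y w u : ZMod p, c 0 * (w + 2 * u - 2 * y) ^ 2 + c 1 * y ^ 2 + c 2 * w ^ 2 +
      c 3 * (2 * w + 2 * u - 3 * y) ^ 2 + c 4 * u ^ 2 = 0 := by
    intro y w u
    obtain ⟨x, h1, h2, h4⟩ := exists_preimage h y w u
    obtain ⟨h0, h3⟩ := toMap_mem h x
    have := congrFun hc x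
    simp only [Fin.sum_univ_five, Pi.add_apply, Pi.smul_apply, smul_eq_mul, Pi.zero_apply, h0, h3,
      h1, h2, h4] at this
    linear_combination this
  have eyy := ev 1 0 0
  have eww := ev 0 1 0
  have euu := ev 0 0 1
  have eyw := ev 1 1 0
  have ewu := ev 0 1 1
  -- The yw and wu cross terms give -4c₀ - 12c₃ = 0 and 4c₀ + 8c₃ = 0; their sum isolates c₃.
  have c3 : c 3 = 0 := by
    have : (2 * 2) * c 3 = 0 := by linear_combination -(eyw - eyy - eww + ewu - eww - euu)
    simpa [two] using this
  have c0 : c 0 = 0 := by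
    have : (2 * 2) * c 0 = 0 := by linear_combination ewu - eww - euu - 8 * c3
    simpa [two] using this
  have c1 : c 1 = 0 := by linear_combination eyy - 4 * c0 - 9 * c3
  have c2 : c 2 = 0 := by linear_combination eww - c0 - 4 * c3
  have c4 : c 4 = 0 := by linear_combination euu - 4 * c0 - 4 * c3
  intro i
  fin_cases i
  exacts [c0, c1, c2, c3, c4]

lemma IsPerturbation.sum_eq_zero {n : ℕ} {α : ℝ} {f : (Fin n → ZMod p) → ℝ}
    (hf : IsPerturbation α f) : ∑ x, f x = 0 := by
  have := hf.2
  rwa [Fintype.expect_eq_sum_div_card, div_eq_zero_iff, or_iff_left] at this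
  exact_mod_cast Fintype.card_ne_zero

lemma re_quarticPart_pos (hp2 : p ≠ 2) (hp3 : p ≠ 3) {n : ℕ} {f : (Fin n → ZMod p) → ℝ}
    (hf : f ≠ 0) : 0 < (quarticPart (fun x => (f x : ℂ))).re := by
  refine lt_of_lt_of_le ?_ (re_quarticPart_ge hp2 hp3 f)
  obtain ⟨ξ, hξ⟩ : ∃ ξ : Fin n → ZMod p, vecFourier (fun x => (f x : ℂ)) ξ ≠ 0 := by
    by_contra! hall
    refine hf (funext fun x => ?_)
    have := fourier_inversion (fun x => (f x : ℂ)) x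
    simpa [hall] using this
  have : 0 < ∑ ξ, ‖vecFourier (fun x => (f x : ℂ)) ξ‖ ^ 4 :=
    Finset.sum_pos' (fun _ _ => pow_nonneg (norm_nonneg _) 4)
      ⟨ξ, Finset.mem_univ _, pow_pos (norm_pos_iff.2 hξ) 4⟩
  exact half_pos this

lemma isWeaklyLocallySidorenko_of_isDefinedBy (hp2 : p ≠ 2) (hp3 : p ≠ 3)
    (hn : Ψ.Nondegenerate) (h : Ψ.IsDefinedBy (exampleMatrix p)) :
    Ψ.IsWeaklyLocallySidorenko := by
  intro n _ α hα f hf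
  have hsum := hf.sum_eq_zero
  have hF0 : vecFourier (fun x => (f x : ℂ)) 0 = 0 := by
    rw [vecFourier_zero, ← Complex.ofReal_sum, hsum]; simp
  have hT : ∀ ε : ℝ, Ψ.T (fun x => α + ε * f x) = α ^ 5 +
      α * ε ^ 4 * (quarticPart (fun x => (f x : ℂ))).re + ε ^ 5 * Ψ.T f := by
    intro ε
    have h1 := ofReal_T_eq_exampleAvg hn h (fun x => α + ε * f x)
    push_cast at h1
    rw [exampleAvg_const_add hp2 hp3 _ hF0, ← ofReal_T_eq_exampleAvg hn h] at h1
    simpa [← Complex.ofReal_pow, ← Complex.ofReal_mul, Complex.re_ofReal_mul]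
      using congrArg Complex.re h1
  by_cases hf0 : f = 0
  · refine ⟨1, one_pos, fun ε _ _ => ?_⟩
    have := hT 0
    simp only [zero_mul, add_zero, ne_eq, OfNat.ofNat_ne_zero, not_false_eq_true, zero_pow,
      mul_zero] at this
    simp [hf0, this]
  · have hα0 : 0 < α := by
      refine lt_of_le_of_ne hα.1 fun h0 => hf0 (funext fun x => ?_)
      have hnn : ∀ x ∈ Finset.univ, 0 ≤ f x := fun x _ => by
        have := (hf.1 x).1
        rwa [← h0, neg_zero] at this
      exact (Finset.sum_eq_zero_iff_of_nonneg hnn).1 hsum x (Finset.mem_univ x)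
    have hQ := re_quarticPart_pos hp2 hp3 hf0
    set Q := (quarticPart (fun x => (f x : ℂ))).re
    -- Below this radius ε|T(f)| ≤ αQ; the added 1 keeps the denominator positive.
    refine ⟨α * Q / (|Ψ.T f| + 1), by positivity, fun ε hε hε' => ?_⟩
    rw [lt_div_iff₀ (by positivity)] at hε'
    rw [hT]
    have h1 : 0 ≤ α * Q + ε * Ψ.T f := by
      have := mul_le_mul_of_nonneg_left (neg_abs_le (Ψ.T f)) hε.le
      linarith
    have := mul_nonneg (pow_nonneg hε.le 4) h1
    linarith

lemma not_isLocallySidorenko_of_isDefinedBy (hp2 : p ≠ 2) (hp3 : p ≠ 3)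
    (hn : Ψ.Nondegenerate) (h : Ψ.IsDefinedBy (exampleMatrix p)) :
    ¬ Ψ.IsLocallySidorenko := by
  intro hloc
  obtain ⟨ε, hε, hall⟩ := hloc (1 / 2) ⟨by norm_num, by norm_num⟩
  obtain ⟨m, hm, f, hf, hsum, hlt⟩ := exists_counterexample hp2 hp3 ε hε
  let e : Fin m ⊕ Fin m ≃ Fin (m + m) := finSumFinEquiv
  have hpert : IsPerturbation (1 / 2) (fun x : Fin (m + m) → ZMod p => f (x ∘ e)) := by
    refine ⟨fun x => ?_, ?_⟩
    · have := abs_le.1 (hf (x ∘ e))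
      exact ⟨this.1, by linarith [this.2]⟩
    · have : ∑ x : Fin (m + m) → ZMod p, f (x ∘ e) = ∑ x, f x :=
        Fintype.sum_equiv (e.arrowCongr (Equiv.refl (ZMod p))).symm _ _ fun _ => rfl
      rw [Fintype.expect_eq_sum_div_card, this, hsum, zero_div]
  have hle := hall (m + m) (by omega) _ hpert
  have hT := ofReal_T_eq_exampleAvg hn h (fun x : Fin (m + m) → ZMod p => 1 / 2 + ε * f (x ∘ e))
  rw [exampleAvg_reindex e (fun x => ((1 / 2 + ε * f x : ℝ) : ℂ))] at hT
  rw [← hT, Complex.ofReal_re] at hlt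
  linarith

lemma exists_isDefinedBy_exampleMatrix (p : ℕ) [Fact p.Prime] :
    ∃ Ψ : FormSystem p 3 5, Ψ.Nondegenerate ∧ Ψ.IsDefinedBy (exampleMatrix p) := by
  let y : (Fin 3 → ZMod p) →ₗ[ZMod p] ZMod p := LinearMap.proj 0
  let w : (Fin 3 → ZMod p) →ₗ[ZMod p] ZMod p := LinearMap.proj 1
  let u : (Fin 3 → ZMod p) →ₗ[ZMod p] ZMod p := LinearMap.proj 2
  let Ψ : FormSystem p 3 5 := ![w + (2 : ZMod p) • u - (2 : ZMod p) • y, y, w,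
    (2 : ZMod p) • w + (2 : ZMod p) • u - (3 : ZMod p) • y, u]
  refine ⟨Ψ, ?_, ?_⟩
  · refine LinearMap.ker_eq_bot'.2 fun x hx => ?_
    ext i
    fin_cases i
    · exact congrFun hx 1
    · exact congrFun hx 2
    · exact congrFun hx 4
  · ext v
    rw [mem_ker_exampleMatrix]
    constructor
    · rintro ⟨x, rfl⟩
      exact ⟨rfl, rfl⟩
    · rintro ⟨h0, h3⟩
      refine ⟨![v 1, v 2, v 4], funext fun i => ?_⟩
      fin_cases i
      · exact h0.symm
      · rfl
      · rfl
      · exact h3.symm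
      · rfl

end FormSystem

theorem corollary1p5 (p : ℕ) [Fact p.Prime] (hp2 : p ≠ 2) (hp3 : p ≠ 3) :
    (¬ ∀ (D t : ℕ) (Ψ : FormSystem p D t), Ψ.Nondegenerate → Ψ.HasComplexity 1 →
        (Ψ.IsWeaklyLocallySidorenko ↔ Ψ.IsLocallySidorenko)) ∧
    (∃ (D : ℕ) (Ψ : FormSystem p D 5),
        Ψ.Nondegenerate ∧ Ψ.IsDefinedBy (FormSystem.exampleMatrix p)) ∧
    (∀ (D : ℕ) (Ψ : FormSystem p D 5),
        Ψ.Nondegenerate → Ψ.IsDefinedBy (FormSystem.exampleMatrix p) →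
        Ψ.HasComplexity 1 ∧ Ψ.IsWeaklyLocallySidorenko ∧ ¬ Ψ.IsLocallySidorenko) := by
  obtain ⟨Ψ, hn, h⟩ := FormSystem.exists_isDefinedBy_exampleMatrix p
  refine ⟨fun hiff => ?_, ⟨3, Ψ, hn, h⟩, fun D Φ hΦ hΦ' =>
    ⟨FormSystem.hasComplexity_one hp2 hΦ',
      FormSystem.isWeaklyLocallySidorenko_of_isDefinedBy hp2 hp3 hΦ hΦ',
      FormSystem.not_isLocallySidorenko_of_isDefinedBy hp2 hp3 hΦ hΦ'⟩⟩
  exact FormSystem.not_isLocallySidorenko_of_isDefinedBy hp2 hp3 hn h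
    ((hiff 3 5 Ψ hn (FormSystem.hasComplexity_one hp2 h)).1
      (FormSystem.isWeaklyLocallySidorenko_of_isDefinedBy hp2 hp3 hn h))
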